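/- Let $\mathbb{K}$ be a field and $m,n\ge 0$ integers, let $(x_{ij})$ be the generic $m\times n$ matrix with entries the variables of the polynomial ring $\mathbb{K}[\mathbf{x}]=\mathbb{K}[x_{11},\dots,x_{mn}]$, and let $I\subset\mathbb{K}[\mathbf{x}]$ be the ideal generated by its $2\times 2$ minors. For an ideal $J\subset\mathbb{K}[\mathbf{x}]$ and an integer $r\ge 0$, the $r$th secant ideal $J^{\{r\}}$ is the $r$-fold join of $J$ with itself, i.e. the elimination ideal $$J^{\{r\}}=\Bigl(J(\mathbf{y}_1)+\cdots+J(\mathbf{y}_r)+\bigl\langle\, y_{1,ij}+\cdots+y_{r,ij}-x_{ij}\;:\;1\le i\le m,\ 1\le j\le n\,\bigr\rangle\Bigr)\cap\mathbb{K}[\mathbf{x}],$$ where $\mathbf{y}_1,\dots,\mathbf{y}_r$ are $r$ new copies of the variables $\mathbf{x}$ and $J(\mathbf{y}_s)$ is the image of $J$ under $\mathbf{x}\mapsto\mathbf{y}_s$ (so $J^{\{1\}}=J$, and $J^{\{0\}}=\langle x_{ij}\rangle$, empty sums being zero). For a term order $\prec$, $\mathrm{in}_\prec(J)$ is the ideal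 generated by the leading terms of the elements of $J$. Call $\prec$ diagonal if for all $i<k$ and $j<l$ the leading term of the minor $x_{ij}x_{kl}-x_{il}x_{kj}$ is $x_{ij}x_{kl}$. Then: 1. Every diagonal term order $\prec$ is delightful for $I$, that is, $\mathrm{in}_\prec(I^{\{r\}})=(\mathrm{in}_\prec(I))^{\{r\}}$ for all $r$. 2. For every $k\ge 1$, the secant ideal $I^{\{k-1\}}$ is generated by the $k\times k$ minors of $(x_{ij})$, and for every diagonal term order $\prec$ these minors form a Gröbner basis of $I^{\{k-1\}}$: they are finitely many elements of $I^{\{k-1\}}$ whose leading terms generate $\mathrm{in}_\prec(I^{\{k-1\}})$. -/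

import Mathlib

universe u v

namespace Secant

open MvPolynomial

noncomputable section

variable {σ K : Type*} [Field K]

/-- The join `I₁ * ⋯ * I_r` of ideals of `K[x]`: in the polynomial ring in the unknowns
`x i` (`Sum.inl i`) and `y j i` (`Sum.inr (j, i)`), take the sum of the ideals `I j (y j)` and of
the ideal generated by all `∑ j, y j i - x i`, and eliminate the unknowns `y`. -/
def join {r : ℕ} (I : Fin r → Ideal (MvPolynomial σ K)) : Ideal (MvPolynomial σ K) :=
  ((⨆ j : Fin r, (I j).map
        (rename (fun i : σ => (Sum.inr (j, i) : σ ⊕ (Fin r × σ))) :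
          MvPolynomial σ K →ₐ[K] MvPolynomial (σ ⊕ (Fin r × σ)) K)) ⊔
      Ideal.span (Set.range fun i : σ =>
        (∑ j : Fin r, X (Sum.inr (j, i))) - X (Sum.inl i))).comap
    (rename (Sum.inl : σ → σ ⊕ (Fin r × σ)) :
      MvPolynomial σ K →ₐ[K] MvPolynomial (σ ⊕ (Fin r × σ)) K)

/-- The `r`th secant ideal: the `r`-fold join of `I` with itself. -/
def secantIdeal (I : Ideal (MvPolynomial σ K)) (r : ℕ) : Ideal (MvPolynomial σ K) :=
  join fun _ : Fin r => I

/-- The initial ideal, generated by the leading terms of all elements of `I`. -/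
def initialIdeal (ord : MonomialOrder σ) (I : Ideal (MvPolynomial σ K)) :
    Ideal (MvPolynomial σ K) :=
  Ideal.span (ord.leadingTerm '' (I : Set (MvPolynomial σ K)))

/-- Taking the `r`th secant commutes with taking the initial ideal. -/
def IsRDelightful (ord : MonomialOrder σ) (I : Ideal (MvPolynomial σ K)) (r : ℕ) : Prop :=
  initialIdeal ord (secantIdeal I r) = secantIdeal (initialIdeal ord I) r

/-- A term order is delightful for `I` if it is `r`-delightful for every `r`.
(Only `2 ≤ r` matters: for `r = 1` both sides are the initial ideal of `I`, and for `r = 0` both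
sides are the ideal generated by the variables.) -/
def IsDelightful (ord : MonomialOrder σ) (I : Ideal (MvPolynomial σ K)) : Prop :=
  ∀ r : ℕ, IsRDelightful ord I r

/-- `G` is a Gröbner basis of `I`. -/
def IsGroebnerBasis (ord : MonomialOrder σ) (G : Set (MvPolynomial σ K))
    (I : Ideal (MvPolynomial σ K)) : Prop :=
  G.Finite ∧ G ⊆ (I : Set (MvPolynomial σ K)) ∧
    Ideal.span (ord.leadingTerm '' G) = initialIdeal ord I

variable (K) in
/-- The `k × k` minor of the generic `m × n` matrix with rows `f 0 < f 1 < ⋯` and columns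
`g 0 < g 1 < ⋯`. -/
def minor {m n k : ℕ} (f : Fin k ↪o Fin m) (g : Fin k ↪o Fin n) :
    MvPolynomial (Fin m × Fin n) K :=
  ((Matrix.mvPolynomialX (Fin m) (Fin n) K).submatrix f g).det

variable (K) in
/-- The set of all `k × k` minors of the generic `m × n` matrix. -/
def minors (m n k : ℕ) : Set (MvPolynomial (Fin m × Fin n) K) :=
  {p | ∃ (f : Fin k ↪o Fin m) (g : Fin k ↪o Fin n), p = minor K f g}

variable (K) in
/-- The ideal generated by the `k × k` minors of the generic `m × n` matrix. -/
def minorIdeal (m n k : ℕ) : Ideal (MvPolynomial (Fin m × Fin n) K) :=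
  Ideal.span (minors K m n k)

variable (K) in
/-- The term order selects the diagonal (leading) term `x_{ij} x_{kl}` of each `2 × 2` minor
`x_{ij} x_{kl} - x_{il} x_{kj}`, where `i < k` and `j < l`. -/
def IsDiagonal {m n : ℕ} (ord : MonomialOrder (Fin m × Fin n)) : Prop :=
  ∀ (f : Fin 2 ↪o Fin m) (g : Fin 2 ↪o Fin n),
    ord.leadingTerm (minor K f g) = X (f 0, g 0) * X (f 1, g 1)

end

end Secant

namespace Secant

open MvPolynomial

noncomputable section

variable {K : Type*} [Field K]

/-- The row and column sums of an exponent matrix, as weights of the matrix positions. -/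
def marginWeight {m n : ℕ} (p : Fin m × Fin n) : Fin m ⊕ Fin n →₀ ℕ :=
  Finsupp.single (Sum.inl p.1) 1 + Finsupp.single (Sum.inr p.2) 1

/-- An exponent matrix is standard if no two positions of its support lie strictly
north-west and south-east of each other. -/
def IsStandard {m n : ℕ} (a : Fin m × Fin n →₀ ℕ) : Prop :=
  ∀ p q, a p ≠ 0 → a q ≠ 0 → p.1 < q.1 → ¬ p.2 < q.2

/-- The monomial order prefers the diagonal of each `2 × 2` submatrix to its antidiagonal. -/
def PrefersDiagonal {m n : ℕ} (ord : MonomialOrder (Fin m × Fin n)) : Prop :=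
  ∀ p q : Fin m × Fin n, p.1 < q.1 → p.2 < q.2 →
    ord.toSyn (Finsupp.single (p.1, q.2) 1 + Finsupp.single (q.1, p.2) 1) <
      ord.toSyn (Finsupp.single p 1 + Finsupp.single q 1)

theorem weight_marginWeight_inl {m n : ℕ} (a : Fin m × Fin n →₀ ℕ) (i : Fin m) :
    Finsupp.weight marginWeight a (Sum.inl i) = ∑ j, a (i, j) := by
  simp [Finsupp.weight_eq_sum, marginWeight, Finsupp.single_apply, Fintype.sum_prod_type,
    Finset.sum_ite_eq']

theorem weight_marginWeight_inr {m n : ℕ} (a : Fin m × Fin n →₀ ℕ) (j : Fin n) :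
    Finsupp.weight marginWeight a (Sum.inr j) = ∑ i, a (i, j) := by
  simp [Finsupp.weight_eq_sum, marginWeight, Finsupp.single_apply, Fintype.sum_prod_type,
    Finset.sum_ite_eq']

/-- The sum of the entries of `a` at the positions satisfying `P`. -/
def mass {m n : ℕ} (a : Fin m × Fin n →₀ ℕ) (P : Fin m × Fin n → Prop) [DecidablePred P] : ℕ :=
  ∑ x, if P x then a x else 0

theorem mass_row_eq {m n : ℕ} {a b : Fin m × Fin n →₀ ℕ}
    (h : Finsupp.weight marginWeight a = Finsupp.weight marginWeight b) (p : ℕ) :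
    mass a (fun x => x.1.1 < p) = mass b (fun x => x.1.1 < p) := by
  simp only [mass, Fintype.sum_prod_type]
  refine Finset.sum_congr rfl fun i _ => ?_
  have := DFunLike.congr_fun h (Sum.inl i)
  rw [weight_marginWeight_inl, weight_marginWeight_inl] at this
  split_ifs <;> simp [this]

theorem mass_col_eq {m n : ℕ} {a b : Fin m × Fin n →₀ ℕ}
    (h : Finsupp.weight marginWeight a = Finsupp.weight marginWeight b) (q : ℕ) :
    mass a (fun x => x.2.1 < q) = mass b (fun x => x.2.1 < q) := by
  simp only [mass, Fintype.sum_prod_type_right]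
  refine Finset.sum_congr rfl fun j _ => ?_
  have := DFunLike.congr_fun h (Sum.inr j)
  rw [weight_marginWeight_inr, weight_marginWeight_inr] at this
  split_ifs <;> simp [this]

theorem mass_inclusion_exclusion {m n : ℕ} (a : Fin m × Fin n →₀ ℕ) (p q : ℕ) :
    mass a (fun x => x.1.1 < p) + mass a (fun x => x.2.1 < q) +
        mass a (fun x => p ≤ x.1.1 ∧ q ≤ x.2.1) =
      mass a (fun x => x.1.1 < m) + mass a (fun x => x.1.1 < p ∧ x.2.1 < q) := by
  simp only [mass, ← Finset.sum_add_distrib]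
  refine Finset.sum_congr rfl fun x _ => ?_
  have := x.1.2
  split_ifs <;> omega

theorem mass_corner_difference {m n : ℕ} (a : Fin m × Fin n →₀ ℕ) (i : Fin m) (j : Fin n) :
    a (i, j) + mass a (fun x => x.1.1 < i.1 ∧ x.2.1 < j.1 + 1) +
        mass a (fun x => x.1.1 < i.1 + 1 ∧ x.2.1 < j.1) =
      mass a (fun x => x.1.1 < i.1 + 1 ∧ x.2.1 < j.1 + 1) +
        mass a (fun x => x.1.1 < i.1 ∧ x.2.1 < j.1) := by
  have h : a (i, j) = mass a (fun x => x.1.1 = i.1 ∧ x.2.1 = j.1) := by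
    rw [mass, Finset.sum_eq_single (i, j)]
    · simp
    · intro x _ hx
      rw [if_neg]
      intro h
      exact hx (Prod.ext (Fin.ext h.1) (Fin.ext h.2))
    · simp
  rw [h]
  simp only [mass, ← Finset.sum_add_distrib]
  refine Finset.sum_congr rfl fun x _ => ?_
  split_ifs <;> omega

theorem IsStandard.mass_eq_zero {m n : ℕ} {a : Fin m × Fin n →₀ ℕ} (ha : IsStandard a)
    (p q : ℕ) : mass a (fun x => x.1.1 < p ∧ x.2.1 < q) = 0 ∨
      mass a (fun x => p ≤ x.1.1 ∧ q ≤ x.2.1) = 0 := by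
  by_contra! h
  obtain ⟨x, -, hx⟩ := Finset.exists_ne_zero_of_sum_ne_zero h.1
  obtain ⟨y, -, hy⟩ := Finset.exists_ne_zero_of_sum_ne_zero h.2
  simp only [ne_eq, ite_eq_right_iff, Classical.not_imp] at hx hy
  exact ha x y hx.2 hy.2 (Fin.lt_def.2 (by omega)) (Fin.lt_def.2 (by omega))

/-- A standard exponent matrix is determined by its row and column sums. -/
theorem IsStandard.eq_of_weight_eq {m n : ℕ} {a b : Fin m × Fin n →₀ ℕ}
    (ha : IsStandard a) (hb : IsStandard b)
    (h : Finsupp.weight marginWeight a = Finsupp.weight marginWeight b) : a = b := by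
  have key (p q : ℕ) : mass a (fun x => x.1.1 < p ∧ x.2.1 < q) =
      mass b (fun x => x.1.1 < p ∧ x.2.1 < q) := by
    have h1 := mass_inclusion_exclusion a p q
    have h2 := mass_inclusion_exclusion b p q
    have h3 := mass_row_eq h p
    have h4 := mass_col_eq h q
    have h5 := mass_row_eq h m
    have h6 := ha.mass_eq_zero p q
    have h7 := hb.mass_eq_zero p q
    omega
  ext ⟨i, j⟩
  have h1 := mass_corner_difference a i j
  have h2 := mass_corner_difference b i j
  simp only [key] at h1
  omega

/-- Among the exponent matrices with given row and column sums, the standard one is the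
smallest. -/
theorem IsStandard.toSyn_le {m n : ℕ} {ord : MonomialOrder (Fin m × Fin n)}
    (hord : PrefersDiagonal ord) {a : Fin m × Fin n →₀ ℕ} (ha : IsStandard a) :
    ∀ b : Fin m × Fin n →₀ ℕ,
      Finsupp.weight marginWeight a = Finsupp.weight marginWeight b →
      ord.toSyn a ≤ ord.toSyn b := by
  refine (InvImage.wf ord.toSyn (wellFounded_lt (α := ord.syn))).fix ?_
  intro b ih h
  by_cases hb : IsStandard b
  · rw [ha.eq_of_weight_eq hb h]
  · simp only [IsStandard, not_forall, not_not] at hb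
    obtain ⟨p, q, hp, hq, h1, h2⟩ := hb
    have hle : Finsupp.single p 1 + Finsupp.single q 1 ≤ b := by
      intro x
      have hpq : p ≠ q := fun e => by simp [e] at h1
      simp only [Finsupp.coe_add, Pi.add_apply, Finsupp.single_apply]
      split_ifs with e1 e2 e2
      · exact absurd (e1.trans e2.symm) hpq
      · subst e1; omega
      · subst e2; omega
      · omega
    obtain ⟨c, rfl⟩ := exists_add_of_le hle
    have hlt : ord.toSyn (Finsupp.single (p.1, q.2) 1 + Finsupp.single (q.1, p.2) 1 + c) <
        ord.toSyn (Finsupp.single p 1 + Finsupp.single q 1 + c) := by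
      rw [map_add, map_add _ _ c]
      exact add_lt_add_left (hord p q h1 h2) _
    refine (ih _ hlt ?_).trans hlt.le
    rw [h]
    simp only [map_add, Finsupp.weight_single, marginWeight]
    simp only [one_smul]
    abel

theorem minor_two {m n : ℕ} (f : Fin 2 ↪o Fin m) (g : Fin 2 ↪o Fin n) :
    minor K f g = X (f 0, g 0) * X (f 1, g 1) - X (f 0, g 1) * X (f 1, g 0) := by
  simp [minor, Matrix.det_fin_two]

/-- The order embedding of `Fin 2` given by two elements. -/
def pairEmb {m : ℕ} {i k : Fin m} (h : i < k) : Fin 2 ↪o Fin m :=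
  OrderEmbedding.ofStrictMono ![i, k] (by simpa [Fin.strictMono_iff_lt_succ] using h)

@[simp] theorem pairEmb_zero {m : ℕ} {i k : Fin m} (h : i < k) : pairEmb h 0 = i := rfl

@[simp] theorem pairEmb_one {m : ℕ} {i k : Fin m} (h : i < k) : pairEmb h 1 = k := rfl

theorem X_mul_X_eq {σ : Type*} (p q : σ) : (X p * X q : MvPolynomial σ K) =
    monomial (Finsupp.single p 1 + Finsupp.single q 1) 1 := by
  simp [X, monomial_mul]

theorem single_add_single_ne {m n : ℕ} {p q : Fin m × Fin n} (h1 : p.1 < q.1) (h2 : p.2 < q.2) :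
    (Finsupp.single (p.1, q.2) 1 + Finsupp.single (q.1, p.2) 1 : Fin m × Fin n →₀ ℕ) ≠
      Finsupp.single p 1 + Finsupp.single q 1 := by
  intro h
  have := DFunLike.congr_fun h p
  simp [Prod.ext_iff, h1.ne', h2.ne'] at this

theorem IsDiagonal.prefersDiagonal {m n : ℕ} {ord : MonomialOrder (Fin m × Fin n)}
    (h : IsDiagonal K ord) : PrefersDiagonal ord := by
  classical
  intro p q h1 h2
  have hne := single_add_single_ne h1 h2
  have h3 := h (pairEmb h1) (pairEmb h2)
  rw [minor_two] at h3
  simp only [pairEmb_zero, pairEmb_one, X_mul_X_eq, Prod.mk.eta] at h3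
  have hdeg := congrArg ord.degree h3
  rw [ord.degree_leadingTerm, ord.degree_monomial, if_neg one_ne_zero] at hdeg
  refine lt_of_le_of_ne ?_ fun e => hne (ord.toSyn.injective e)
  rw [← hdeg]
  apply ord.le_degree
  simp [coeff_monomial, hne.symm]

variable {σ τ : Type*}

/-- The substitution `x i ↦ ∑ s, y s i` which defines joins. -/
def sumCopies (σ K : Type*) [Field K] (r : ℕ) :
    MvPolynomial σ K →ₐ[K] MvPolynomial (Fin r × σ) K :=
  aeval fun p => ∑ s, X (s, p)

/-- The sum of the ideals `I(y_s)` in the `r` copies of the variables. -/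
def copiesIdeal (I : Ideal (MvPolynomial σ K)) (r : ℕ) : Ideal (MvPolynomial (Fin r × σ) K) :=
  ⨆ s : Fin r, I.map (rename (Prod.mk s) : MvPolynomial σ K →ₐ[K] MvPolynomial (Fin r × σ) K)

theorem mem_secantIdeal_iff (I : Ideal (MvPolynomial σ K)) (r : ℕ) (f : MvPolynomial σ K) :
    f ∈ secantIdeal I r ↔ sumCopies σ K r f ∈ copiesIdeal I r := by
  constructor
  · intro hf
    let T : MvPolynomial (σ ⊕ (Fin r × σ)) K →ₐ[K] MvPolynomial (Fin r × σ) K :=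
      aeval (Sum.elim (fun p => ∑ s, X (s, p)) X)
    have hT : T.comp (rename Sum.inl) = sumCopies σ K r := by
      ext p; simp [T, sumCopies]
    have hle : ((⨆ j : Fin r, I.map
        (rename (fun i : σ => (Sum.inr (j, i) : σ ⊕ (Fin r × σ))) :
          MvPolynomial σ K →ₐ[K] MvPolynomial (σ ⊕ (Fin r × σ)) K)) ⊔
      Ideal.span (Set.range fun i : σ =>
        (∑ j : Fin r, X (Sum.inr (j, i))) - X (Sum.inl i))) ≤ (copiesIdeal I r).comap T := by
      refine sup_le (iSup_le fun s => ?_) ?_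
      · rw [Ideal.map_le_iff_le_comap]
        intro g hg
        have h1 : T (rename (fun i : σ => (Sum.inr (s, i) : σ ⊕ (Fin r × σ))) g) =
            rename (Prod.mk s) g := by
          rw [aeval_rename, rename_eq_aeval]
          rfl
        rw [Ideal.mem_comap, Ideal.mem_comap, h1]
        exact Ideal.mem_iSup_of_mem s (Ideal.mem_map_of_mem _ hg)
      · rw [Ideal.span_le]
        rintro _ ⟨p, rfl⟩
        simp [T]
    have := hle hf
    rw [Ideal.mem_comap] at this
    rw [← hT]
    exact this
  · intro hf
    let Q : Ideal (MvPolynomial (σ ⊕ (Fin r × σ)) K) := (⨆ j : Fin r, I.map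
        (rename (fun i : σ => (Sum.inr (j, i) : σ ⊕ (Fin r × σ))) :
          MvPolynomial σ K →ₐ[K] MvPolynomial (σ ⊕ (Fin r × σ)) K)) ⊔
      Ideal.span (Set.range fun i : σ =>
        (∑ j : Fin r, X (Sum.inr (j, i))) - X (Sum.inl i))
    change rename Sum.inl f ∈ Q
    have h1 : ((Ideal.Quotient.mkₐ K Q).comp (rename Sum.inl)) =
        ((Ideal.Quotient.mkₐ K Q).comp (rename Sum.inr)).comp (sumCopies σ K r) := by
      ext p
      simp only [AlgHom.comp_apply, rename_X, sumCopies, aeval_X, map_sum]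
      rw [← map_sum, eq_comm, Ideal.Quotient.mkₐ_eq_mk, Ideal.Quotient.eq]
      exact Ideal.mem_sup_right (Ideal.subset_span ⟨p, rfl⟩)
    have h2 : copiesIdeal I r ≤ Q.comap (rename Sum.inr : _ →ₐ[K] _) := by
      refine iSup_le fun s => ?_
      rw [Ideal.map_le_iff_le_comap]
      intro g hg
      rw [Ideal.mem_comap, Ideal.mem_comap, rename_rename]
      exact Ideal.mem_sup_left (Ideal.mem_iSup_of_mem s (Ideal.mem_map_of_mem _ hg))
    have h3 := AlgHom.congr_fun h1 f
    simp only [AlgHom.comp_apply, Ideal.Quotient.mkₐ_eq_mk] at h3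
    rw [← Ideal.Quotient.eq_zero_iff_mem, h3, Ideal.Quotient.eq_zero_iff_mem]
    exact h2 hf

/-- A homomorphism killing every copy of `I` kills the image of the secant ideal. -/
theorem map_sumCopies_eq_zero {R : Type*} [CommRing R] [Algebra K R]
    {I : Ideal (MvPolynomial σ K)} {r : ℕ} {f : MvPolynomial σ K} (hf : f ∈ secantIdeal I r)
    (φ : MvPolynomial (Fin r × σ) K →ₐ[K] R)
    (hφ : ∀ s, ∀ g ∈ I, φ (rename (Prod.mk s) g) = 0) : φ (sumCopies σ K r f) = 0 := by
  have h : copiesIdeal I r ≤ RingHom.ker φ := by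
    refine iSup_le fun s => ?_
    rw [Ideal.map_le_iff_le_comap]
    exact fun g hg => hφ s g hg
  exact h ((mem_secantIdeal_iff I r f).1 hf)

theorem constantCoeff_eq_zero_of_mem_secantIdeal_zero {I : Ideal (MvPolynomial σ K)}
    {f : MvPolynomial σ K} (hf : f ∈ secantIdeal I 0) : coeff 0 f = 0 := by
  have h := map_sumCopies_eq_zero hf
    (aeval (fun _ => (0 : K)) : MvPolynomial (Fin 0 × σ) K →ₐ[K] K) (fun s => s.elim0)
  have h2 : ((aeval (fun _ => (0 : K)) : MvPolynomial (Fin 0 × σ) K →ₐ[K] K).comp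
      (sumCopies σ K 0)) = aeval (fun _ => (0 : K)) := by
    ext p; simp [sumCopies]
  have h3 := AlgHom.congr_fun h2 f
  rw [AlgHom.comp_apply, h] at h3
  rw [← constantCoeff_eq, ← show (aeval (fun _ => (0 : K)) f) = constantCoeff f by simp]
  exact h3.symm

theorem coeff_killCompl {f : σ → τ} (hf : Function.Injective f) (a : σ →₀ ℕ)
    (g : MvPolynomial τ K) : coeff a (killCompl hf g) = coeff (a.mapDomain f) g := by
  classical
  induction g using MvPolynomial.induction_on' with
  | monomial u c =>
    by_cases hu : (u.support : Set τ) ⊆ Set.range f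
    · rw [← Finsupp.mapDomain_comapDomain f hf u hu, killCompl_monomial_mapDomain, coeff_monomial,
        coeff_monomial]
      simp only [(Finsupp.mapDomain_injective hf).eq_iff]
    · rw [killCompl_monomial_eq_zero_of_not_subset hf c hu, coeff_monomial, if_neg, coeff_zero]
      rintro rfl
      refine hu fun x hx => ?_
      obtain ⟨y, -, rfl⟩ := Finset.mem_image.1 (Finsupp.mapDomain_support hx)
      exact ⟨y, rfl⟩
  | add p q hp hq => rw [map_add, coeff_add, coeff_add, hp, hq]

/-- Cancellation in the image of `f` under a monomial substitution forces two monomials of `f`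
to have the same image. -/
theorem exists_ne_weight_eq {w : σ → τ →₀ ℕ} {f : MvPolynomial σ K}
    (hf : aeval (fun i => monomial (w i) (1 : K)) f = 0) {A : σ →₀ ℕ} (hA : coeff A f ≠ 0) :
    ∃ B, coeff B f ≠ 0 ∧ B ≠ A ∧ Finsupp.weight w B = Finsupp.weight w A := by
  classical
  by_contra! h
  have hmon (B : σ →₀ ℕ) (c : K) : aeval (fun i => monomial (w i) (1 : K)) (monomial B c) =
      monomial (Finsupp.weight w B) c := by
    rw [aeval_monomial, Finsupp.weight_apply, Finsupp.sum, monomial_sum_index]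
    simp [Finsupp.prod, monomial_pow, algebraMap_eq]
  have h1 := congrArg (coeff (Finsupp.weight w A)) hf
  rw [f.as_sum, map_sum, coeff_sum, Finset.sum_eq_single A] at h1
  · rw [hmon, coeff_monomial, if_pos rfl, coeff_zero] at h1
    exact hA h1
  · intro B hB hne
    rw [hmon, coeff_monomial, if_neg (h B (mem_support_iff.1 hB) hne)]
  · intro hn
    exact absurd (mem_support_iff.2 hA) hn

/-- The monomials of `f (∑ s, y s)` are obtained by splitting those of `f`. -/
theorem coeff_weight_ne_zero_of_sumCopies {r : ℕ} {f : MvPolynomial σ K} {B : Fin r × σ →₀ ℕ}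
    (hB : coeff B (sumCopies σ K r f) ≠ 0) :
    coeff (Finsupp.weight (fun x : Fin r × σ => (Finsupp.single x.2 1 : σ →₀ ℕ)) B) f ≠ 0 := by
  classical
  set w := fun x : Fin r × σ => (Finsupp.single x.2 1 : σ →₀ ℕ)
  rw [f.as_sum, map_sum, coeff_sum] at hB
  obtain ⟨b, hb, hne⟩ := Finset.exists_ne_zero_of_sum_ne_zero hB
  have hom : IsWeightedHomogeneous w (sumCopies σ K r (monomial b (coeff b f))) b := by
    rw [sumCopies, aeval_monomial, algebraMap_eq]
    refine IsWeightedHomogeneous.C_mul ?_ _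
    have h1 : IsWeightedHomogeneous w
        (∏ p ∈ b.support, (∑ s : Fin r, X (s, p) : MvPolynomial (Fin r × σ) K) ^ b p)
        (∑ p ∈ b.support, b p • Finsupp.single p 1) := by
      refine IsWeightedHomogeneous.prod _ _ _ fun p _ => IsWeightedHomogeneous.pow ?_ _
      exact IsWeightedHomogeneous.sum _ _ _ fun s _ => isWeightedHomogeneous_X K w (s, p)
    have h2 : ∑ p ∈ b.support, b p • Finsupp.single p 1 = b := by
      conv_rhs => rw [← Finsupp.sum_single b]
      simp [Finsupp.sum]
    rwa [h2] at h1
  rw [hom hne]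
  exact mem_support_iff.1 hb

/-- The exponent of the product of the variables along a chain of matrix positions. -/
def chainExponent {m n k : ℕ} (f : Fin k ↪o Fin m) (g : Fin k ↪o Fin n) : Fin m × Fin n →₀ ℕ :=
  ∑ t, Finsupp.single (f t, g t) 1

/-- The exponents of the products of the variables along the chains of `k` matrix positions. -/
def chainExponents (m n k : ℕ) : Set (Fin m × Fin n →₀ ℕ) :=
  {a | ∃ (f : Fin k ↪o Fin m) (g : Fin k ↪o Fin n), a = chainExponent f g}

variable (K) in
/-- The monomial ideal generated by the diagonal terms of the `k × k` minors. -/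
def chainIdeal (m n k : ℕ) : Ideal (MvPolynomial (Fin m × Fin n) K) :=
  Ideal.span ((fun s => monomial s (1 : K)) '' chainExponents m n k)

theorem chainExponent_apply {m n k : ℕ} (f : Fin k ↪o Fin m) (g : Fin k ↪o Fin n)
    (x : Fin m × Fin n) : chainExponent f g x = if ∃ t, (f t, g t) = x then 1 else 0 := by
  classical
  rw [chainExponent, Finsupp.finsetSum_apply]
  split_ifs with h
  · obtain ⟨t, rfl⟩ := h
    rw [Finset.sum_eq_single t]
    · simp
    · intro s _ hs
      rw [Finsupp.single_apply, if_neg]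
      intro e
      exact hs (f.injective (Prod.ext_iff.1 e).1)
    · simp
  · refine Finset.sum_eq_zero fun t _ => ?_
    rw [Finsupp.single_apply, if_neg]
    exact fun e => h ⟨t, e⟩

/-- There is a chain of `k + 1` positions of `W` which starts at `p`. -/
def HasChainFrom {m n : ℕ} (W : Set (Fin m × Fin n)) : ℕ → Fin m × Fin n → Prop
  | 0, p => p ∈ W
  | k + 1, p => p ∈ W ∧ ∃ q, p.1 < q.1 ∧ p.2 < q.2 ∧ HasChainFrom W k q

theorem HasChainFrom.exists_strictMono {m n : ℕ} {W : Set (Fin m × Fin n)} (k : ℕ) :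
    ∀ p, HasChainFrom W k p → ∃ (f : Fin (k + 1) → Fin m) (g : Fin (k + 1) → Fin n),
      StrictMono f ∧ StrictMono g ∧ (f 0, g 0) = p ∧ ∀ t, (f t, g t) ∈ W := by
  induction k with
  | zero =>
    intro p hp
    have : Subsingleton (Fin (0 + 1)) := inferInstanceAs (Subsingleton (Fin 1))
    exact ⟨fun _ => p.1, fun _ => p.2, Subsingleton.strictMono _, Subsingleton.strictMono _, rfl,
      fun _ => hp⟩
  | succ k ih =>
    rintro p ⟨hp, q, h1, h2, hq⟩
    obtain ⟨f, g, hf, hg, rfl, hW⟩ := ih q hq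
    refine ⟨Matrix.vecCons p.1 f, Matrix.vecCons p.2 g, strictMono_vecCons.2 ⟨h1, hf⟩,
      strictMono_vecCons.2 ⟨h2, hg⟩, rfl, fun t => Fin.cases hp hW t⟩

/-- A set of positions without chains of length `r + 2` is a union of `r + 1` antichains. -/
theorem exists_coloring {m n : ℕ} {W : Set (Fin m × Fin n)} {r : ℕ}
    (hW : ∀ (f : Fin (r + 2) ↪o Fin m) (g : Fin (r + 2) ↪o Fin n), ∃ t, (f t, g t) ∉ W) :
    ∃ c : Fin m × Fin n → Fin (r + 1),
      ∀ p ∈ W, ∀ q ∈ W, p.1 < q.1 → p.2 < q.2 → c p ≠ c q := by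
  classical
  have hno (p) : ¬ HasChainFrom W (r + 1) p := by
    intro h
    obtain ⟨f, g, hf, hg, -, hfg⟩ := h.exists_strictMono
    obtain ⟨t, ht⟩ := hW (OrderEmbedding.ofStrictMono f hf) (OrderEmbedding.ofStrictMono g hg)
    exact ht (hfg t)
  refine ⟨fun p => ⟨Nat.findGreatest (fun k => HasChainFrom W k p) r,
    Nat.lt_succ_of_le (Nat.findGreatest_le r)⟩, ?_⟩
  intro p hp q hq h1 h2 heq
  rw [Fin.mk.injEq] at heq
  have hq' : HasChainFrom W (Nat.findGreatest (fun k => HasChainFrom W k q) r) q :=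
    Nat.findGreatest_spec (P := fun k => HasChainFrom W k q) (Nat.zero_le r) hq
  have hp' : HasChainFrom W (Nat.findGreatest (fun k => HasChainFrom W k q) r + 1) p :=
    ⟨hp, q, h1, h2, hq'⟩
  rcases Nat.lt_or_ge r (Nat.findGreatest (fun k => HasChainFrom W k q) r + 1) with h | h
  · have : Nat.findGreatest (fun k => HasChainFrom W k q) r = r :=
      le_antisymm (Nat.findGreatest_le r) (by omega)
    rw [this] at hp'
    exact hno p hp'
  · have := Nat.le_findGreatest (P := fun k => HasChainFrom W k p) h hp'
    omega

/-- Chain ideals are detected by colorings of the supports of monomials. -/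
theorem mem_chainIdeal_of_coloring {m n r : ℕ} {f : MvPolynomial (Fin m × Fin n) K}
    (h : ∀ a ∈ f.support, ¬ ∃ c : Fin m × Fin n → Fin (r + 1),
      ∀ p q, a p ≠ 0 → a q ≠ 0 → p.1 < q.1 → p.2 < q.2 → c p ≠ c q) :
    f ∈ chainIdeal K m n (r + 2) := by
  rw [chainIdeal, mem_ideal_span_monomial_image]
  intro a ha
  by_contra! hn
  refine h a ha ?_
  obtain ⟨c, hc⟩ := exists_coloring (W := {p | a p ≠ 0}) (r := r) (by
    intro f g
    by_contra! hfg
    refine hn _ ⟨f, g, rfl⟩ ?_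
    intro x
    rw [chainExponent_apply]
    split_ifs with hx
    · obtain ⟨t, rfl⟩ := hx
      exact Nat.one_le_iff_ne_zero.2 (hfg t)
    · exact Nat.zero_le _)
  exact ⟨c, fun p q hp hq => hc p hp q hq⟩

theorem mem_chainIdeal_one {m n : ℕ} {f : MvPolynomial (Fin m × Fin n) K}
    (h : coeff 0 f = 0) : f ∈ chainIdeal K m n 1 := by
  rw [chainIdeal, mem_ideal_span_monomial_image]
  intro a ha
  have ha0 : a ≠ 0 := by
    rintro rfl
    exact mem_support_iff.1 ha h
  obtain ⟨p, hp⟩ := Finsupp.ne_iff.1 ha0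
  refine ⟨_, ⟨OrderEmbedding.ofStrictMono (fun _ => p.1) (Subsingleton.strictMono _),
    OrderEmbedding.ofStrictMono (fun _ => p.2) (Subsingleton.strictMono _), rfl⟩, fun x => ?_⟩
  rw [chainExponent_apply]
  split_ifs with hx
  · obtain ⟨t, rfl⟩ := hx
    exact Nat.one_le_iff_ne_zero.2 hp
  · exact Nat.zero_le _

/-- Secants of the ideal of 2-chains are contained in chain ideals. -/
theorem secantIdeal_chainIdeal_le (m n r : ℕ) :
    secantIdeal (chainIdeal K m n 2) r ≤ chainIdeal K m n (r + 1) := by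
  classical
  intro f hf
  rcases r with - | r
  · exact mem_chainIdeal_one (constantCoeff_eq_zero_of_mem_secantIdeal_zero hf)
  refine mem_chainIdeal_of_coloring ?_
  rintro a ha ⟨c, hc⟩
  let φ : MvPolynomial (Fin (r + 1) × (Fin m × Fin n)) K →ₐ[K] MvPolynomial (Fin m × Fin n) K :=
    aeval fun x => if c x.2 = x.1 ∧ a x.2 ≠ 0 then X x.2 else 0
  have h0 : φ (sumCopies _ K (r + 1) f) = 0 := by
    refine map_sumCopies_eq_zero hf φ fun s g hg => ?_
    have : chainIdeal K m n 2 ≤ RingHom.ker (φ.comp (rename (Prod.mk s))) := by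
      rw [chainIdeal, Ideal.span_le]
      rintro _ ⟨_, ⟨u, v, rfl⟩, rfl⟩
      simp only [chainExponent, Fin.sum_univ_two, SetLike.mem_coe, RingHom.mem_ker]
      rw [← X_mul_X_eq]
      simp only [AlgHom.comp_apply, map_mul, rename_X, φ, aeval_X]
      by_cases h1 : c (u 0, v 0) = s ∧ a (u 0, v 0) ≠ 0
      · by_cases h2 : c (u 1, v 1) = s ∧ a (u 1, v 1) ≠ 0
        · exact absurd (h1.1.trans h2.1.symm) (hc _ _ h1.2 h2.2 (u.strictMono Fin.zero_lt_one)
            (v.strictMono Fin.zero_lt_one))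
        · rw [if_neg h2, mul_zero]
      · rw [if_neg h1, zero_mul]
    exact this hg
  have h1 : φ.comp (sumCopies _ K (r + 1)) = aeval fun p => if a p ≠ 0 then X p else 0 := by
    ext1 p
    simp only [AlgHom.comp_apply, sumCopies, aeval_X, map_sum, φ]
    rw [Finset.sum_eq_single (c p)]
    · simp
    · intro s _ hs
      rw [if_neg]
      exact fun e => hs e.1.symm
    · simp
  have h2 : killCompl (R := K) (Subtype.val_injective (p := fun p => a p ≠ 0)) f = 0 := by
    apply rename_injective _ Subtype.val_injective
    rw [map_zero, ← h0, ← AlgHom.comp_apply, ← AlgHom.comp_apply, h1]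
    congr 1
    ext1 p
    simp only [AlgHom.comp_apply, killCompl, aeval_X]
    by_cases hp : a p ≠ 0
    · rw [dif_pos (by simpa using hp), rename_X, if_pos hp]
      congr 1
      exact congrArg Subtype.val ((Equiv.ofInjective _ Subtype.val_injective).symm_apply_apply
        (⟨p, hp⟩ : {p // a p ≠ 0}))
    · rw [dif_neg (by simpa using hp), map_zero, if_neg hp]
  have h3 := coeff_killCompl (K := K) (Subtype.val_injective (p := fun p => a p ≠ 0))
    (a.comapDomain Subtype.val Subtype.val_injective.injOn) f
  rw [h2, Finsupp.mapDomain_comapDomain _ Subtype.val_injective, coeff_zero] at h3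
  · exact mem_support_iff.1 ha h3.symm
  · intro p hp
    simpa using hp

/-- The monomial parametrization of `r`-tuples of matrices of rank at most one. -/
def segreWeight {m n r : ℕ} (x : Fin r × (Fin m × Fin n)) : Fin r × (Fin m ⊕ Fin n) →₀ ℕ :=
  Finsupp.single (x.1, Sum.inl x.2.1) 1 + Finsupp.single (x.1, Sum.inr x.2.2) 1

theorem aeval_segreWeight_sumCopies {m n r : ℕ} {f : MvPolynomial (Fin m × Fin n) K}
    (hf : f ∈ secantIdeal (minorIdeal K m n 2) r) :
    aeval (fun i => monomial (segreWeight i) (1 : K)) (sumCopies _ K r f) = 0 := by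
  refine map_sumCopies_eq_zero hf _ fun s g hg => ?_
  rw [← AlgHom.comp_apply]
  have : minorIdeal K m n 2 ≤ RingHom.ker ((aeval
      (fun i => monomial (segreWeight (m := m) (n := n) (r := r) i) (1 : K))).comp
        (rename (Prod.mk s))) := by
    rw [minorIdeal, Ideal.span_le]
    rintro _ ⟨u, v, rfl⟩
    rw [minor_two, SetLike.mem_coe, RingHom.mem_ker]
    simp only [AlgHom.comp_apply, map_sub, map_mul, rename_X, aeval_X, monomial_mul]
    rw [sub_eq_zero]
    congr 2
    simp only [segreWeight]
    abel
  exact this hg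

/-- The `s`th matrix in an `r`-tuple of exponent matrices. -/
def component {σ : Type*} {r : ℕ} (B : Fin r × σ →₀ ℕ) (s : Fin r) : σ →₀ ℕ :=
  B.comapDomain (Prod.mk s) (Prod.mk_right_injective s).injOn

@[simp] theorem component_apply {σ : Type*} {r : ℕ} (B : Fin r × σ →₀ ℕ) (s : Fin r) (p : σ) :
    component B s p = B (s, p) := rfl

theorem weight_snd_eq_sum_component {σ : Type*} [Fintype σ] {r : ℕ} (B : Fin r × σ →₀ ℕ) :
    Finsupp.weight (fun x : Fin r × σ => (Finsupp.single x.2 1 : σ →₀ ℕ)) B =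
      ∑ s, component B s := by
  classical
  ext p
  simp [Finsupp.weight_eq_sum, Fintype.sum_prod_type, Finsupp.single_apply]

theorem weight_marginWeight_component {m n r : ℕ} {A B : Fin r × (Fin m × Fin n) →₀ ℕ}
    (h : Finsupp.weight segreWeight A = Finsupp.weight segreWeight B) (s : Fin r) :
    Finsupp.weight marginWeight (component A s) = Finsupp.weight marginWeight (component B s) := by
  have key (C : Fin r × (Fin m × Fin n) →₀ ℕ) (e) :
      Finsupp.weight marginWeight (component C s) e = Finsupp.weight segreWeight C (s, e) := by
    rw [Finsupp.weight_eq_sum, Finsupp.weight_eq_sum, Finsupp.finsetSum_apply,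
      Finsupp.finsetSum_apply, Fintype.sum_prod_type (f := fun x => (C x • segreWeight x) (s, e)),
      Finset.sum_eq_single s]
    · rcases e with i | j <;>
      simp [marginWeight, segreWeight, Finsupp.single_apply]
    · intro t _ hts
      simp [segreWeight, hts]
    · simp
  ext e
  rw [key, key, h]

/-- A leading monomial of an element of the secant ideal cannot be split into standard
monomials. -/
theorem not_coloring_of_mem_secantIdeal {m n r : ℕ} {ord : MonomialOrder (Fin m × Fin n)}
    (hord : PrefersDiagonal ord) {f : MvPolynomial (Fin m × Fin n) K}
    (hf : f ∈ secantIdeal (minorIdeal K m n 2) r) (hf0 : f ≠ 0)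
    (c : Fin m × Fin n → Fin r)
    (hc : ∀ p q, ord.degree f p ≠ 0 → ord.degree f q ≠ 0 → p.1 < q.1 → p.2 < q.2 → c p ≠ c q) :
    False := by
  classical
  set a := ord.degree f with ha
  have hinj : Function.Injective fun p : Fin m × Fin n => (c p, p) :=
    fun p q h => (Prod.ext_iff.1 h).2
  set A : Fin r × (Fin m × Fin n) →₀ ℕ := a.mapDomain fun p => (c p, p) with hA
  have hAc (s) (p) : component A s p = if c p = s then a p else 0 := by
    rw [component_apply]
    split_ifs with h
    · subst h
      exact Finsupp.mapDomain_apply hinj a p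
    · refine Finsupp.mapDomain_of_notMem_range _ _ ?_
      rintro ⟨q, hq⟩
      obtain ⟨h1, rfl⟩ := Prod.ext_iff.1 hq
      exact h h1
  have hstd (s) : IsStandard (component A s) := by
    intro p q hp hq h1 h2
    rw [hAc, ne_eq, ite_eq_right_iff, Classical.not_imp] at hp hq
    exact hc p q hp.2 hq.2 h1 h2 (hp.1.trans hq.1.symm)
  have hsum : ∑ s, component A s = a := by
    ext p
    simp [Finsupp.finsetSum_apply, hAc, -component_apply]
  have hcomp : (killCompl hinj).comp (sumCopies (Fin m × Fin n) K r) = AlgHom.id K _ := by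
    ext1 p
    simp only [AlgHom.comp_apply, sumCopies, aeval_X, map_sum, AlgHom.id_apply]
    rw [Finset.sum_eq_single (c p)]
    · have := killCompl_rename_app (R := K) hinj (X p)
      rwa [rename_X] at this
    · intro s _ hs
      rw [killCompl, aeval_X, dif_neg]
      rintro ⟨q, hq⟩
      obtain ⟨h1, rfl⟩ := Prod.ext_iff.1 hq
      exact hs h1.symm
    · simp
  have hcoeff : coeff A (sumCopies _ K r f) ≠ 0 := by
    rw [hA, ← coeff_killCompl hinj, ← AlgHom.comp_apply, hcomp]
    exact ord.coeff_degree_ne_zero_iff.2 hf0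
  obtain ⟨B, hB, hBA, hw⟩ := exists_ne_weight_eq (aeval_segreWeight_sumCopies hf) hcoeff
  have hB' := coeff_weight_ne_zero_of_sumCopies hB
  rw [weight_snd_eq_sum_component] at hB'
  have hle : ord.toSyn (∑ s, component B s) ≤ ord.toSyn (∑ s, component A s) := by
    rw [hsum]
    exact ord.le_degree (mem_support_iff.2 hB')
  have hge (s) : ord.toSyn (component A s) ≤ ord.toSyn (component B s) :=
    (hstd s).toSyn_le hord _ (weight_marginWeight_component hw.symm s)
  obtain ⟨s, hs⟩ : ∃ s, component A s ≠ component B s := by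
    by_contra! hn
    refine hBA (Finsupp.ext fun x => ?_)
    exact (DFunLike.congr_fun (hn x.1) x.2).symm
  rw [map_sum, map_sum] at hle
  refine absurd hle (not_le.2 (Finset.sum_lt_sum (fun s _ => hge s) ⟨s, Finset.mem_univ s, ?_⟩))
  exact lt_of_le_of_ne (hge s) fun e => hs (ord.toSyn.injective e)

theorem leadingTerm_mem_chainIdeal {m n r : ℕ} {ord : MonomialOrder (Fin m × Fin n)}
    (hord : PrefersDiagonal ord) {f : MvPolynomial (Fin m × Fin n) K}
    (hf : f ∈ secantIdeal (minorIdeal K m n 2) r) :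
    ord.leadingTerm f ∈ chainIdeal K m n (r + 1) := by
  classical
  by_cases hf0 : f = 0
  · rw [hf0, ord.leadingTerm_zero]
    exact zero_mem _
  rcases r with - | r
  · have h0 := constantCoeff_eq_zero_of_mem_secantIdeal_zero hf
    refine mem_chainIdeal_one ?_
    rw [MonomialOrder.leadingTerm, coeff_monomial]
    split_ifs with h
    · rwa [MonomialOrder.leadingCoeff, h]
    · rfl
  · refine mem_chainIdeal_of_coloring ?_
    intro a ha
    rw [ord.support_leadingTerm' hf0, Finset.mem_singleton] at ha
    subst ha
    rintro ⟨c, hc⟩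
    exact not_coloring_of_mem_secantIdeal hord hf hf0 c hc

@[to_additive]
theorem prod_eq_mul_mul_prod_compl {ι M : Type*} [Fintype ι] [DecidableEq ι] [CommMonoid M]
    {i j : ι} (h : i ≠ j) (F : ι → M) :
    ∏ t, F t = F i * F j * ∏ t ∈ ({i, j} : Finset ι)ᶜ, F t := by
  rw [← Finset.prod_mul_prod_compl {i, j} F, Finset.prod_pair h]

theorem swap_apply_of_mem_compl {ι : Type*} [Fintype ι] [DecidableEq ι] {i j t : ι}
    (h : t ∈ ({i, j} : Finset ι)ᶜ) : Equiv.swap i j t = t := by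
  simp only [Finset.mem_compl, Finset.mem_insert, Finset.mem_singleton, not_or] at h
  exact Equiv.swap_apply_of_ne_of_ne h.1 h.2

/-- A determinant vanishes if the `2 × 2` minors of a pair of rows do. -/
theorem det_eq_zero_of_rows {ι R : Type*} [Fintype ι] [DecidableEq ι] [CommRing R]
    {M : Matrix ι ι R} {i i' : ι} (hi : i ≠ i')
    (h : ∀ j j', M i j * M i' j' = M i j' * M i' j) : M.det = 0 := by
  rw [← Matrix.det_transpose, Matrix.det_apply]
  refine Finset.sum_involution (fun σ _ => σ * Equiv.swap i i') ?_ ?_ ?_ ?_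
  · intro σ _
    have : ∏ t, M.transpose ((σ * Equiv.swap i i') t) t = ∏ t, M.transpose (σ t) t := by
      rw [prod_eq_mul_mul_prod_compl hi, prod_eq_mul_mul_prod_compl hi]
      congr 1
      · simp only [Matrix.transpose_apply, Equiv.Perm.mul_apply, Equiv.swap_apply_left,
          Equiv.swap_apply_right]
        exact h _ _
      · refine Finset.prod_congr rfl fun t ht => ?_
        rw [Equiv.Perm.mul_apply, swap_apply_of_mem_compl ht]
    rw [this, Equiv.Perm.sign_mul, Equiv.Perm.sign_swap hi]
    simp
  · intro σ _ _ e
    have h1 := mul_eq_left.1 e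
    exact hi (Equiv.swap_eq_one_iff.1 h1)
  · intro σ _
    exact Finset.mem_univ _
  · intro σ _
    simp [mul_assoc]

/-- The determinant of a sum of fewer matrices of rank at most one than its size vanishes. -/
theorem det_sum_eq_zero {R : Type*} [CommRing R] {r : ℕ}
    (Y : Fin r → Matrix (Fin (r + 1)) (Fin (r + 1)) R)
    (h : ∀ s i i' j j', Y s i j * Y s i' j' = Y s i j' * Y s i' j) :
    (∑ s, Y s).det = 0 := by
  have h1 : (∑ s, Y s).det = Matrix.detRowAlternating fun i => ∑ s, Y s i := by
    change Matrix.detRowAlternating _ = _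
    congr 1
    ext i j
    rw [Matrix.sum_apply, Finset.sum_apply]
  rw [h1, ← AlternatingMap.coe_multilinearMap, MultilinearMap.map_sum]
  refine Finset.sum_eq_zero fun κ _ => ?_
  obtain ⟨i, i', hi, hκ⟩ := Fintype.exists_ne_map_eq_of_card_lt κ (by simp)
  refine det_eq_zero_of_rows hi fun j j' => ?_
  rw [hκ]
  exact h _ _ _ _ _

theorem sub_mem_minorIdeal_two {m n : ℕ} (i i' : Fin m) (j j' : Fin n) :
    (X (i, j) * X (i', j') - X (i, j') * X (i', j) : MvPolynomial (Fin m × Fin n) K) ∈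
      minorIdeal K m n 2 := by
  have key {i i' : Fin m} {j j' : Fin n} (hi : i < i') (hj : j < j') :
      (X (i, j) * X (i', j') - X (i, j') * X (i', j) : MvPolynomial (Fin m × Fin n) K) ∈
        minorIdeal K m n 2 := by
    have h := minor_two (K := K) (pairEmb hi) (pairEmb hj)
    simp only [pairEmb_zero, pairEmb_one] at h
    rw [← h]
    exact Ideal.subset_span ⟨_, _, rfl⟩
  rcases lt_trichotomy i i' with hi | rfl | hi
  · rcases lt_trichotomy j j' with hj | rfl | hj
    · exact key hi hj
    · simp
    · rw [← neg_sub]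
      exact neg_mem (key hi hj)
  · rw [mul_comm, sub_self]
    exact zero_mem _
  · rcases lt_trichotomy j j' with hj | rfl | hj
    · convert neg_mem (key hi hj) using 1
      ring
    · rw [sub_self]
      exact zero_mem _
    · convert key hi hj using 1
      ring

theorem minor_mem_secantIdeal {m n r : ℕ} (f : Fin (r + 1) ↪o Fin m) (g : Fin (r + 1) ↪o Fin n) :
    minor K f g ∈ secantIdeal (minorIdeal K m n 2) r := by
  rw [mem_secantIdeal_iff, ← Ideal.Quotient.eq_zero_iff_mem]
  set J := copiesIdeal (minorIdeal K m n 2) r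
  let Y (s : Fin r) : Matrix (Fin (r + 1)) (Fin (r + 1)) _ :=
    Matrix.of fun i j => Ideal.Quotient.mk J (X (s, (f i, g j)))
  have h1 : Ideal.Quotient.mk J (sumCopies _ K r (minor K f g)) = (∑ s, Y s).det := by
    rw [minor, AlgHom.map_det, RingHom.map_det]
    congr 1
    ext i j
    simp [sumCopies, Y, Matrix.sum_apply]
  rw [h1]
  refine det_sum_eq_zero Y fun s i i' j j' => ?_
  simp only [Y, Matrix.of_apply, ← map_mul]
  rw [Ideal.Quotient.eq]
  have h2 := Ideal.mem_map_of_mem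
    (rename (Prod.mk s) : _ →ₐ[K] MvPolynomial (Fin r × (Fin m × Fin n)) K)
    (sub_mem_minorIdeal_two (K := K) (f i) (f i') (g j) (g j'))
  simp only [map_sub, map_mul, rename_X] at h2
  exact Ideal.mem_iSup_of_mem s h2

/-- The exponent of the term of a minor which belongs to the permutation `σ`. -/
def permExponent {m n k : ℕ} (f : Fin k ↪o Fin m) (g : Fin k ↪o Fin n) (σ : Equiv.Perm (Fin k)) :
    Fin m × Fin n →₀ ℕ :=
  ∑ t, Finsupp.single (f t, g (σ t)) 1

theorem permExponent_injective {m n k : ℕ} (f : Fin k ↪o Fin m) (g : Fin k ↪o Fin n) :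
    Function.Injective (permExponent f g) := by
  classical
  have key (σ : Equiv.Perm (Fin k)) (t u : Fin k) :
      permExponent f g σ (f t, g u) = if σ t = u then 1 else 0 := by
    rw [permExponent, Finsupp.finsetSum_apply, Finset.sum_eq_single t]
    · simp [Finsupp.single_apply]
    · intro s _ hs
      simp [hs]
    · simp
  intro σ τ h
  ext t
  have h1 := key τ t (σ t)
  rw [← h, key, if_pos rfl] at h1
  by_contra hne
  rw [if_neg fun e => hne (by rw [e])] at h1
  exact one_ne_zero h1

theorem permExponent_lt_of_swap {m n k : ℕ} {ord : MonomialOrder (Fin m × Fin n)}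
    (hord : PrefersDiagonal ord) (f : Fin k ↪o Fin m) (g : Fin k ↪o Fin n)
    (τ : Equiv.Perm (Fin k)) {t u : Fin k} (h1 : t < u) (h2 : τ u < τ t) :
    ord.toSyn (permExponent f g τ) < ord.toSyn (permExponent f g (τ * Equiv.swap t u)) := by
  rw [permExponent, permExponent, sum_eq_add_add_sum_compl h1.ne,
    sum_eq_add_add_sum_compl h1.ne, map_add, map_add ord.toSyn (_ + _)]
  have h3 : ∑ x ∈ ({t, u} : Finset (Fin k))ᶜ,
      Finsupp.single (f x, g ((τ * Equiv.swap t u) x)) 1 =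
      ∑ x ∈ ({t, u} : Finset (Fin k))ᶜ, Finsupp.single (f x, g (τ x)) 1 :=
    Finset.sum_congr rfl fun x hx => by rw [Equiv.Perm.mul_apply, swap_apply_of_mem_compl hx]
  rw [h3]
  refine add_lt_add_left ?_ _
  simp only [Equiv.Perm.mul_apply, Equiv.swap_apply_left, Equiv.swap_apply_right]
  exact hord (f t, g (τ u)) (f u, g (τ t)) (f.strictMono h1) (g.strictMono h2)

theorem permExponent_le_one {m n k : ℕ} {ord : MonomialOrder (Fin m × Fin n)}
    (hord : PrefersDiagonal ord) (f : Fin k ↪o Fin m) (g : Fin k ↪o Fin n)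
    (σ : Equiv.Perm (Fin k)) :
    ord.toSyn (permExponent f g σ) ≤ ord.toSyn (permExponent f g 1) := by
  obtain ⟨τ, hτ⟩ := Finite.exists_max fun σ => ord.toSyn (permExponent f g σ)
  have hmono : StrictMono τ := by
    intro t u htu
    by_contra hn
    have hlt : τ u < τ t :=
      lt_of_le_of_ne (not_lt.1 hn) fun e => htu.ne (τ.injective e).symm
    exact absurd (hτ _) (not_le.2 (permExponent_lt_of_swap hord f g τ htu hlt))
  have h1 : τ = 1 := by
    have h2 := Subsingleton.elim (hmono.orderIsoOfSurjective τ τ.surjective) (OrderIso.refl _)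
    ext1 t
    exact DFunLike.congr_fun h2 t
  rw [← h1]
  exact hτ σ

theorem permExponent_one {m n k : ℕ} (f : Fin k ↪o Fin m) (g : Fin k ↪o Fin n) :
    permExponent f g 1 = chainExponent f g := rfl

theorem minor_eq_sum {m n k : ℕ} (f : Fin k ↪o Fin m) (g : Fin k ↪o Fin n) :
    minor K f g = ∑ σ : Equiv.Perm (Fin k),
      monomial (permExponent f g σ) ((Equiv.Perm.sign σ : ℤ) : K) := by
  rw [minor, ← Matrix.det_transpose, Matrix.det_apply']
  refine Finset.sum_congr rfl fun σ _ => ?_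
  have h : ∏ t, (X (f t, g (σ t)) : MvPolynomial (Fin m × Fin n) K) =
      monomial (permExponent f g σ) 1 := by
    rw [permExponent, monomial_sum_one]
    rfl
  simp only [Matrix.transpose_apply, Matrix.submatrix_apply, Matrix.mvPolynomialX_apply]
  rw [h, ← map_intCast (C : K →+* MvPolynomial (Fin m × Fin n) K), C_mul_monomial, mul_one]

theorem coeff_chainExponent_minor {m n k : ℕ} (f : Fin k ↪o Fin m) (g : Fin k ↪o Fin n) :
    coeff (chainExponent f g) (minor K f g) = 1 := by
  classical
  rw [minor_eq_sum, coeff_sum, Finset.sum_eq_single 1]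
  · rw [coeff_monomial, permExponent_one, if_pos rfl]
    simp
  · intro σ _ hσ
    rw [coeff_monomial, if_neg]
    intro e
    exact hσ (permExponent_injective f g e)
  · simp

theorem degree_minor {m n k : ℕ} {ord : MonomialOrder (Fin m × Fin n)}
    (hord : PrefersDiagonal ord) (f : Fin k ↪o Fin m) (g : Fin k ↪o Fin n) :
    ord.degree (minor K f g) = chainExponent f g := by
  classical
  refine ord.toSyn.injective (le_antisymm ?_ ?_)
  · rw [minor_eq_sum]
    refine ord.degree_sum_le.trans (Finset.sup_le fun σ _ => ?_)
    exact (ord.degree_monomial_le _).trans (permExponent_le_one hord f g σ)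
  · refine ord.le_degree (mem_support_iff.2 ?_)
    rw [coeff_chainExponent_minor]
    exact one_ne_zero

theorem leadingCoeff_minor {m n k : ℕ} {ord : MonomialOrder (Fin m × Fin n)}
    (hord : PrefersDiagonal ord) (f : Fin k ↪o Fin m) (g : Fin k ↪o Fin n) :
    ord.leadingCoeff (minor K f g) = 1 := by
  rw [MonomialOrder.leadingCoeff, degree_minor hord, coeff_chainExponent_minor]

/-- The leading term of a minor is the product along its diagonal. -/
theorem leadingTerm_minor {m n k : ℕ} {ord : MonomialOrder (Fin m × Fin n)}
    (hord : PrefersDiagonal ord) (f : Fin k ↪o Fin m) (g : Fin k ↪o Fin n) :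
    ord.leadingTerm (minor K f g) = monomial (chainExponent f g) 1 := by
  rw [MonomialOrder.leadingTerm, leadingCoeff_minor hord, degree_minor hord]

theorem span_leadingTerm_minors {m n : ℕ} {ord : MonomialOrder (Fin m × Fin n)}
    (hord : PrefersDiagonal ord) (k : ℕ) :
    Ideal.span (ord.leadingTerm '' minors K m n k) = chainIdeal K m n k := by
  rw [chainIdeal]
  congr 1
  ext p
  constructor
  · rintro ⟨_, ⟨f, g, rfl⟩, rfl⟩
    exact ⟨_, ⟨f, g, rfl⟩, (leadingTerm_minor hord f g).symm⟩
  · rintro ⟨_, ⟨f, g, rfl⟩, rfl⟩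
    exact ⟨_, ⟨f, g, rfl⟩, leadingTerm_minor hord f g⟩

theorem minors_subset_secantIdeal (m n r : ℕ) :
    minors K m n (r + 1) ⊆ (secantIdeal (minorIdeal K m n 2) r : Set _) := by
  rintro _ ⟨f, g, rfl⟩
  exact minor_mem_secantIdeal f g

theorem initialIdeal_secantIdeal {m n : ℕ} {ord : MonomialOrder (Fin m × Fin n)}
    (hord : PrefersDiagonal ord) (r : ℕ) :
    initialIdeal ord (secantIdeal (minorIdeal K m n 2) r) = chainIdeal K m n (r + 1) := by
  refine le_antisymm ?_ ?_
  · rw [initialIdeal, Ideal.span_le]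
    rintro _ ⟨f, hf, rfl⟩
    exact leadingTerm_mem_chainIdeal hord hf
  · rw [← span_leadingTerm_minors hord]
    exact Ideal.span_mono (Set.image_mono (minors_subset_secantIdeal m n r))

theorem initialIdeal_minorIdeal_two {m n : ℕ} {ord : MonomialOrder (Fin m × Fin n)}
    (hord : PrefersDiagonal ord) :
    initialIdeal ord (minorIdeal K m n 2) = chainIdeal K m n 2 := by
  refine le_antisymm ?_ ?_
  · rw [← initialIdeal_secantIdeal hord 1]
    refine Ideal.span_mono (Set.image_mono ?_)
    exact Ideal.span_le.2 (minors_subset_secantIdeal m n 1)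
  · rw [← span_leadingTerm_minors hord]
    exact Ideal.span_mono (Set.image_mono Ideal.subset_span)

theorem chainIdeal_le_secantIdeal (m n r : ℕ) :
    chainIdeal K m n (r + 1) ≤ secantIdeal (chainIdeal K m n 2) r := by
  classical
  rw [chainIdeal, Ideal.span_le]
  rintro _ ⟨_, ⟨f, g, rfl⟩, rfl⟩
  rw [SetLike.mem_coe, mem_secantIdeal_iff]
  have h1 : sumCopies _ K r (monomial (chainExponent f g) 1) =
      ∏ t, ∑ s, X (s, (f t, g t)) := by
    have : (monomial (chainExponent f g) 1 : MvPolynomial (Fin m × Fin n) K) =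
        ∏ t, X (f t, g t) := by
      rw [chainExponent, monomial_sum_one]
      rfl
    rw [this, map_prod]
    simp [sumCopies]
  rw [h1, Finset.prod_univ_sum]
  refine sum_mem fun κ _ => ?_
  have key {t u : Fin (r + 1)} (htu : t < u) (hκ : κ t = κ u) :
      ∏ i, X (κ i, (f i, g i)) ∈ copiesIdeal (chainIdeal K m n 2) r := by
    rw [prod_eq_mul_mul_prod_compl htu.ne]
    refine Ideal.mul_mem_right _ _ (Ideal.mem_iSup_of_mem (κ t) ?_)
    have h2 : (X (f t, g t) * X (f u, g u) : MvPolynomial (Fin m × Fin n) K) ∈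
        chainIdeal K m n 2 := by
      refine Ideal.subset_span ⟨_, ⟨pairEmb (f.strictMono htu), pairEmb (g.strictMono htu), rfl⟩,
        ?_⟩
      simp [chainExponent, Fin.sum_univ_two, X_mul_X_eq]
    have h3 := Ideal.mem_map_of_mem
      (rename (Prod.mk (κ t)) : _ →ₐ[K] MvPolynomial (Fin r × (Fin m × Fin n)) K) h2
    rw [map_mul, rename_X, rename_X] at h3
    rwa [← hκ]
  obtain ⟨t, u, hne, hκ⟩ := Fintype.exists_ne_map_eq_of_card_lt κ (by simp)
  rcases lt_or_gt_of_ne hne with h | h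
  · exact key h hκ
  · exact key h hκ.symm

/-- Elements of `I` whose leading terms are monic and divide the leading terms of all elements
of `I` generate `I`. -/
theorem le_span_of_degree_le {σ : Type*} {ord : MonomialOrder σ} {G : Set (MvPolynomial σ K)}
    {I : Ideal (MvPolynomial σ K)} (hG : G ⊆ (I : Set (MvPolynomial σ K)))
    (hmonic : ∀ g ∈ G, ord.leadingCoeff g = 1)
    (hdvd : ∀ f ∈ I, f ≠ 0 → ∃ g ∈ G, ord.degree g ≤ ord.degree f) : I ≤ Ideal.span G := by
  intro f hf
  obtain ⟨c, h, hfch, -, hh⟩ :=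
    ord.div_set (B := G) (fun g hg => by rw [hmonic g hg]; exact isUnit_one) f
  have hc : Finsupp.linearCombination _ (fun b : G => (b : MvPolynomial σ K)) c ∈
      Ideal.span G := by
    rw [Finsupp.linearCombination_apply]
    exact sum_mem fun b _ => Ideal.mul_mem_left _ _ (Ideal.subset_span b.2)
  have hhI : h ∈ I := by
    rw [eq_sub_iff_add_eq'.2 hfch.symm]
    exact sub_mem hf (Ideal.span_le.2 hG hc)
  have h0 : h = 0 := by
    by_contra hne
    obtain ⟨g, hg, hle⟩ := hdvd h hhI hne
    exact hh _ (ord.degree_mem_support hne) g hg hle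
  rw [hfch, h0, add_zero]
  exact hc

/-- The lexicographic order for which the variables decrease along the rows of the matrix. -/
def rowLex (m n : ℕ) : MonomialOrder (Fin m × Fin n) :=
  (MonomialOrder.lex : MonomialOrder (Fin m ×ₗ Fin n))

theorem prefersDiagonal_rowLex (m n : ℕ) : PrefersDiagonal (rowLex m n) := by
  intro p q h1 h2
  change toLex (α := (Fin m ×ₗ Fin n) →₀ ℕ) _ < toLex _
  refine Finsupp.Lex.lt_iff.2 ⟨toLex p, fun d hd => ?_, ?_⟩
  · obtain ⟨d, rfl⟩ := toLex.surjective d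
    have hd' : d.1 < p.1 ∨ d.1 = p.1 ∧ d.2 < p.2 := Prod.Lex.lt_iff.1 hd
    change (Finsupp.single (p.1, q.2) 1 + Finsupp.single (q.1, p.2) 1 : Fin m × Fin n →₀ ℕ) d =
      (Finsupp.single p 1 + Finsupp.single q 1 : Fin m × Fin n →₀ ℕ) d
    have e1 : (p.1, q.2) ≠ d := by rintro rfl; simp at hd'; omega
    have e2 : (q.1, p.2) ≠ d := by rintro rfl; simp at hd'; omega
    have e3 : p ≠ d := by rintro rfl; omega
    have e4 : q ≠ d := by rintro rfl; omega
    rw [Finsupp.add_apply, Finsupp.add_apply, Finsupp.single_apply, Finsupp.single_apply,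
      Finsupp.single_apply, Finsupp.single_apply, if_neg e1, if_neg e2, if_neg e3, if_neg e4]
  · change (Finsupp.single (p.1, q.2) 1 + Finsupp.single (q.1, p.2) 1 : Fin m × Fin n →₀ ℕ) p <
      (Finsupp.single p 1 + Finsupp.single q 1 : Fin m × Fin n →₀ ℕ) p
    simp [Prod.ext_iff, h1.ne', h2.ne']

theorem secantIdeal_minorIdeal (m n r : ℕ) :
    secantIdeal (minorIdeal K m n 2) r = minorIdeal K m n (r + 1) := by
  have hord := prefersDiagonal_rowLex m n
  refine le_antisymm ?_ (Ideal.span_le.2 (minors_subset_secantIdeal m n r))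
  refine le_span_of_degree_le (ord := rowLex m n) (minors_subset_secantIdeal m n r) ?_ ?_
  · rintro _ ⟨f, g, rfl⟩
    exact leadingCoeff_minor hord f g
  · classical
    intro p hp hp0
    have h := leadingTerm_mem_chainIdeal hord hp
    rw [chainIdeal, mem_ideal_span_monomial_image] at h
    obtain ⟨_, ⟨f, g, rfl⟩, hle⟩ := h ((rowLex m n).degree p) (by
      rw [MonomialOrder.support_leadingTerm' hp0, Finset.mem_singleton])
    exact ⟨_, ⟨f, g, rfl⟩, by rwa [degree_minor hord]⟩

theorem minors_finite (m n k : ℕ) : (minors K m n k).Finite := by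
  have : minors K m n k = Set.range fun x : (Fin k ↪o Fin m) × (Fin k ↪o Fin n) =>
      minor K x.1 x.2 := by
    ext p
    constructor
    · rintro ⟨f, g, rfl⟩
      exact ⟨(f, g), rfl⟩
    · rintro ⟨⟨f, g⟩, rfl⟩
      exact ⟨f, g, rfl⟩
  rw [this]
  exact Set.finite_range _

end

end Secant

theorem theorem4p9 {K : Type u} [Field K] (m n : ℕ) :
    (∀ ord : MonomialOrder.{0, v} (Fin m × Fin n), Secant.IsDiagonal K ord →
      Secant.IsDelightful ord (Secant.minorIdeal K m n 2)) ∧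
    (∀ r : ℕ,
      Secant.secantIdeal (Secant.minorIdeal K m n 2) r = Secant.minorIdeal K m n (r + 1) ∧
      ∀ ord : MonomialOrder.{0, v} (Fin m × Fin n), Secant.IsDiagonal K ord →
        Secant.IsGroebnerBasis ord (Secant.minors K m n (r + 1))
          (Secant.secantIdeal (Secant.minorIdeal K m n 2) r)) := by
  refine ⟨fun ord hord r => ?_, fun r => ⟨Secant.secantIdeal_minorIdeal m n r, fun ord hord =>
    ⟨Secant.minors_finite m n _, Secant.minors_subset_secantIdeal m n r, ?_⟩⟩⟩
  · rw [Secant.IsRDelightful, Secant.initialIdeal_secantIdeal hord.prefersDiagonal,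
      Secant.initialIdeal_minorIdeal_two hord.prefersDiagonal]
    exact le_antisymm (Secant.chainIdeal_le_secantIdeal m n r)
      (Secant.secantIdeal_chainIdeal_le m n r)
  · rw [Secant.span_leadingTerm_minors hord.prefersDiagonal,
      Secant.initialIdeal_secantIdeal hord.prefersDiagonal]
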